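/- Let $X$ and $Z$ be finite non-empty sets with the same number of elements, equipped with symmetric functions $d_X\colon X\times X\to\mathbb{R}^+$ and $d_Z\colon Z\times Z\to\mathbb{R}^+$, where $\mathbb{R}^+=[0,\infty)$ (no triangle inequality is assumed and distinct points may have value $0$), and let $f_\bullet\colon X\to Z$ be a bijection. All vector spaces are over $\mathbb{Z}_2$. **Definitions.** $\mathrm{VR}_r(Z)$ is the graph with vertex set $Z$ that has no edges if $r=0$, and for $r>0$ has the edges $[z,z']$, $z\ne z'$, with $d_Z(z,z')\le r$. $H_0(\mathrm{VR}_r(Z))$ is the vector space with basis the connected components of $\mathrm{VR}_r(Z)$, $[z]$ is the component of $z$, and $\mathrm{PH}_0(Z)$ is the persistence module (functor from $(\mathbb{R}^+,\le)$ to vector spaces) formed by the $H_0(\mathrm{VR}_r(Z))$ and the maps $\rho^Z_{rs}\colon[z]\mapsto[z]$, $r\le s$. For $a\in\mathbb{R}^+\cup\{\infty\}$, $\kappa^a$ is the interval module with $\kappa^a_r=\mathbb{Z}_2$ if $r<a$ or $r=0$, and $\kappa^a_r=0$ otherwise; its structure maps are the identity between two copies of $\mathbb{Z}_2$ and zero otherwise.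 For $a\ge b$, $\kappa^a\to\kappa^b$ is the persistence morphism which at $r$ is the identity if $\kappa^a_r=\kappa^b_r=\mathbb{Z}_2$, and zero otherwise. Two persistence morphisms are isomorphic, $\simeq$, if there are persistence isomorphisms between their sources and between their targets that form a commutative square with them; direct sums are taken pointwise. For $b>0$ put $\ker^+_b(Z)=\ker\rho^Z_{0b}$ and $\ker^-_b(Z)=\bigcup_{0\le r<b}\ker\rho^Z_{0r}$. Put $\ker^-_0(Z)=0$, and let $\ker^+_0(Z)$ be the span in $H_0(\mathrm{VR}_0(Z))$ of all $[z]+[z']$ for which there is a chain $z=y_0,y_1,\dots,y_m=z'$ in $Z$, $m\ge 0$, with $d_Z(y_{i},y_{i+1})=0$ for all $i<m$. The same is defined for $X$. Let $f_0\colon H_0(\mathrm{VR}_0(X))\to H_0(\mathrm{VR}_0(Z))$ be the isomorphism $[x]\mapsto[f_\bullet(x)]$, and for $a,b\in\mathbb{R}^+$ let $$\mathcal{M}^0_f(a,b)=\dim\frac{f_0(\ker^+_a(X))\cap\ker^+_b(Z)}{f_0(\ker^-_a(X))\cap\ker^+_b(Z)+f_0(\ker^+_a(X))\cap\ker^-_b(Z)}.$$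 For $\delta\in\mathbb{R}^+$ let $X^\delta$ be the set $X$ with the function $d_{X^\delta}(x,x')=d_X(x,x')+\delta$, and let $f^\delta_\bullet\colon X^\delta\to Z$ be the map $f_\bullet$. It is called non-expansive if $d_{X^\delta}(x,x')\ge d_Z(f_\bullet(x),f_\bullet(x'))$ for all $x,x'\in X$. **Lemma.** There is $\delta_0\in\mathbb{R}^+$ such that $f^\delta_\bullet$ is non-expansive for all $\delta\ge\delta_0$. Whenever $\delta\in\mathbb{R}^+$ is such that $f^\delta_\bullet$ is non-expansive, the assignment $[x]\mapsto[f_\bullet(x)]$, at each $r\in\mathbb{R}^+$, defines a persistence morphism $f^\delta\colon\mathrm{PH}_0(X^\delta)\to\mathrm{PH}_0(Z)$, and $$f^\delta\simeq\Bigl(\bigoplus_{b\in\mathbb{R}^+}\bigoplus_{a\ge b}\ \bigoplus_{i\in\{1,2,\dots,\mathcal{M}^0_{f^\delta}(a,b)\}}(\kappa^a\to\kappa^b)\Bigr)\oplus(\kappa^\infty\to\kappa^\infty).$$ -/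

import Mathlib

open CategoryTheory
open scoped NNReal ENNReal DirectSum

noncomputable section

namespace PersistenceMatching

/-- A symmetric function with non-negative real values on a set `X`.  Neither the triangle
inequality nor `dist x y = 0 ↔ x = y` is required. -/
structure SymFun (X : Type) where
  /-- the underlying function -/
  dist : X → X → ℝ≥0
  symm : ∀ x y, dist x y = dist y x

/-- The shifted function `d^δ (x, x') = d (x, x') + δ`. -/
def SymFun.shift {X : Type} (d : SymFun X) (δ : ℝ≥0) : SymFun X where
  dist x y := d.dist x y + δ
  symm x y := by rw [d.symm x y]

/-- `f : (X, dX) → (Z, dZ)` is non-expansive. -/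
def NonExpansive {X Z : Type} (dX : SymFun X) (dZ : SymFun Z) (f : X → Z) : Prop :=
  ∀ x x', dZ.dist (f x) (f x') ≤ dX.dist x x'

/-! ### The Vietoris-Rips graphs and their 0-homology -/

/-- The graph on `X` whose edges join the pairs of different points with `d x x' ≤ r`. -/
def thresholdGraph {X : Type} (d : SymFun X) (r : ℝ≥0) : SimpleGraph X where
  Adj x y := x ≠ y ∧ d.dist x y ≤ r
  symm := ⟨fun x y h => ⟨h.1.symm, by rw [d.symm y x]; exact h.2⟩⟩
  loopless := ⟨fun _ h => h.1 rfl⟩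

open Classical in
/-- The 1-skeleton of the Vietoris-Rips complex at `r`: there are no edges at `r = 0`, and for
`r > 0` the edges are the pairs with `d x x' ≤ r`. -/
def VR {X : Type} (d : SymFun X) (r : ℝ≥0) : SimpleGraph X :=
  if r = 0 then ⊥ else thresholdGraph d r

theorem VR_zero {X : Type} (d : SymFun X) : VR d 0 = ⊥ := if_pos rfl

theorem VR_mono {X : Type} (d : SymFun X) {r s : ℝ≥0} (h : r ≤ s) : VR d r ≤ VR d s := by
  unfold VR
  split_ifs with hr
  · exact le_rfl
  · exact bot_le
  · rename_i hs
    exact absurd (le_antisymm (hs ▸ h) (zero_le (a := r))) hr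
  · exact fun x y hxy => ⟨hxy.1, hxy.2.trans h⟩

/-- The 0-homology of a graph: the free `ℤ/2`-vector space on its connected components. -/
abbrev H0 {X : Type} (G : SimpleGraph X) : Type := G.ConnectedComponent →₀ ZMod 2

/-- The generator `[x]` of the 0-homology of a graph given by the component of `x`. -/
def cls {X : Type} (G : SimpleGraph X) (x : X) : H0 G :=
  Finsupp.single (G.connectedComponentMk x) 1

/-- The linear map `[x] ↦ [φ x]` induced on 0-homology by a graph homomorphism `φ`. -/
def H0map {X Z : Type} {G : SimpleGraph X} {H : SimpleGraph Z} (φ : G →g H) :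
    H0 G →ₗ[ZMod 2] H0 H :=
  Finsupp.lmapDomain (ZMod 2) (ZMod 2) (SimpleGraph.ConnectedComponent.map φ)

/-- The map `ρ_{rs}` induced by the inclusion of `VR d r` in `VR d s`. -/
def rho {X : Type} (d : SymFun X) {r s : ℝ≥0} (h : r ≤ s) :
    H0 (VR d r) →ₗ[ZMod 2] H0 (VR d s) :=
  H0map (SimpleGraph.Hom.ofLE (VR_mono d h))

theorem rho_refl {X : Type} (d : SymFun X) (r : ℝ≥0) (h : r ≤ r) :
    rho d h = LinearMap.id := by
  apply Finsupp.lhom_ext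
  intro c a
  induction c using SimpleGraph.ConnectedComponent.ind
  simp [rho, H0map]

theorem rho_trans {X : Type} (d : SymFun X) {r s t : ℝ≥0} (h : r ≤ s) (h' : s ≤ t) :
    rho d (h.trans h') = rho d h' ∘ₗ rho d h := by
  apply Finsupp.lhom_ext
  intro c a
  induction c using SimpleGraph.ConnectedComponent.ind
  simp [rho, H0map]

/-! ### Persistence modules -/

/-- Persistence modules over `ℤ/2` indexed by the non-negative reals, with persistence morphisms
as morphisms. -/
abbrev PersMod : Type 1 := ℝ≥0 ⥤ ModuleCat.{0} (ZMod 2)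

/-- The 0-persistent homology of `(X, d)`. -/
def PH0 {X : Type} (d : SymFun X) : PersMod where
  obj r := ModuleCat.of (ZMod 2) (H0 (VR d r))
  map g := ModuleCat.ofHom (rho d (leOfHom g))
  map_id r := by rw [rho_refl]; rfl
  map_comp g h := by rw [rho_trans d (leOfHom g) (leOfHom h)]; rfl

open Classical in
/-- The vector space `κ^a_r`, a subspace of `ℤ/2`, for `a ∈ [0, ∞]`: it is all of `ℤ/2` if `r < a`,
and also if `r = 0`, so that `κ^0` is concentrated at `0`; it is zero otherwise. -/
def kappaSpace (a : ℝ≥0∞) (r : ℝ≥0) : Submodule (ZMod 2) (ZMod 2) :=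
  if r = 0 ∨ (r : ℝ≥0∞) < a then ⊤ else ⊥

open Classical in
/-- The identity map of `ℤ/2` when both subspaces are `ℤ/2`, and zero when one of them is zero. -/
def idOrZero (A B : Submodule (ZMod 2) (ZMod 2)) : A →ₗ[ZMod 2] B :=
  if h : A ≤ B then Submodule.inclusion h else 0

theorem idOrZero_self (A : Submodule (ZMod 2) (ZMod 2)) : idOrZero A A = LinearMap.id := by
  rw [idOrZero, dif_pos le_rfl]; rfl

theorem idOrZero_comp {A B C : Submodule (ZMod 2) (ZMod 2)} (hBA : B ≤ A) (hCB : C ≤ B) :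
    idOrZero B C ∘ₗ idOrZero A B = idOrZero A C := by
  unfold idOrZero
  by_cases hAB : A ≤ B
  · obtain rfl := le_antisymm hAB hBA
    rw [dif_pos le_rfl]; rfl
  · have hAC : ¬ A ≤ C := fun h => hAB (h.trans hCB)
    rw [dif_neg hAB, dif_neg hAC, LinearMap.comp_zero]

theorem kappaSpace_anti (a : ℝ≥0∞) {r s : ℝ≥0} (h : r ≤ s) : kappaSpace a s ≤ kappaSpace a r := by
  unfold kappaSpace
  split_ifs with hs hr hr
  · exact le_rfl
  · exfalso
    rcases hs with rfl | hs
    · exact hr (Or.inl (le_antisymm h (zero_le (a := r))))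
    · exact hr (Or.inr (lt_of_le_of_lt (by exact_mod_cast h) hs))
  · exact bot_le
  · exact le_rfl

theorem kappaSpace_mono {a b : ℝ≥0∞} (h : b ≤ a) (r : ℝ≥0) : kappaSpace b r ≤ kappaSpace a r := by
  unfold kappaSpace
  split_ifs with hb ha ha
  · exact le_rfl
  · exact absurd (hb.imp_right fun hb => hb.trans_le h) ha
  · exact bot_le
  · exact le_rfl

/-- The interval module `κ^a`, for `a ∈ [0, ∞]`. -/
def kappa (a : ℝ≥0∞) : PersMod where
  obj r := ModuleCat.of (ZMod 2) (kappaSpace a r)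
  map {r s} _ := ModuleCat.ofHom (idOrZero (kappaSpace a r) (kappaSpace a s))
  map_id r := by rw [idOrZero_self]; rfl
  map_comp g h := by
    rw [← idOrZero_comp (kappaSpace_anti a (leOfHom g)) (kappaSpace_anti a (leOfHom h))]; rfl

/-- The persistence morphism `κ^a → κ^b` for `a ≥ b`: at `r` it is the identity of `ℤ/2` if both
spaces are `ℤ/2`, and zero otherwise. -/
def kappaHom {a b : ℝ≥0∞} (h : b ≤ a) : kappa a ⟶ kappa b where
  app r := ModuleCat.ofHom (idOrZero (kappaSpace a r) (kappaSpace b r))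
  naturality r s g := by
    have h1 := idOrZero_comp (kappaSpace_anti a (leOfHom g)) (kappaSpace_mono h s)
    have h2 := idOrZero_comp (kappaSpace_mono h r) (kappaSpace_anti b (leOfHom g))
    exact ModuleCat.hom_ext (h1.trans h2.symm)

/-- The direct sum of a family of persistence modules, taken pointwise. -/
def directSum {ι : Type} (V : ι → PersMod) : PersMod where
  obj r := ModuleCat.of (ZMod 2) (⨁ i, (V i).obj r)
  map g := ModuleCat.ofHom (DirectSum.lmap fun i => ((V i).map g).hom)
  map_id r := by
    apply ModuleCat.hom_ext
    refine LinearMap.ext fun v => DFinsupp.ext fun i => ?_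
    exact (DirectSum.lmap_apply _ _ _).trans (by rw [(V i).map_id]; rfl)
  map_comp g h := by
    apply ModuleCat.hom_ext
    refine LinearMap.ext fun v => DFinsupp.ext fun i => ?_
    exact (DirectSum.lmap_apply _ _ _).trans (by rw [(V i).map_comp]; rfl)

/-- The direct sum of a family of persistence morphisms. -/
def directSumHom {ι : Type} {V W : ι → PersMod} (φ : ∀ i, V i ⟶ W i) :
    directSum V ⟶ directSum W where
  app r := ModuleCat.ofHom (DirectSum.lmap fun i => ((φ i).app r).hom)
  naturality r s g := by
    apply ModuleCat.hom_ext
    refine LinearMap.ext fun v => DFinsupp.ext fun i => ?_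
    exact congrArg (fun k => k.hom ((show ⨁ i, (V i).obj r from v) i)) ((φ i).naturality g)

/-! ### The induced block function -/

/-- `ker⁻_b = ⋃_{0 ≤ r < b} ker ρ_{0r}`; the union is increasing, hence equal to the supremum of
subspaces, and at `b = 0` the supremum is over the empty family, so `ker⁻_0 = 0`. -/
def kerMinus {X : Type} (d : SymFun X) (b : ℝ≥0) : Submodule (ZMod 2) (H0 (VR d 0)) :=
  ⨆ r : ℝ≥0, ⨆ _ : r < b, LinearMap.ker (rho d (zero_le (a := r)))

open Classical in
/-- `ker⁺_b = ker ρ_{0b}` for `b > 0`, while `ker⁺_0` is spanned by the sums `[x] + [x']` of points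
joined by a chain of pairs at value `0`.  (The sums of each point with a chosen representative of
its chain component, such as the one of smallest label, span the same space.) -/
def kerPlus {X : Type} (d : SymFun X) (b : ℝ≥0) : Submodule (ZMod 2) (H0 (VR d 0)) :=
  if b = 0 then
    Submodule.span (ZMod 2)
      {v | ∃ x x', (thresholdGraph d 0).Reachable x x' ∧ v = cls (VR d 0) x + cls (VR d 0) x'}
  else LinearMap.ker (rho d (zero_le (a := b)))

/-- The linear map `f_0 : H_0(VR_0(X)) → H_0(VR_0(Z))`, `[x] ↦ [f x]`; it exists for every `f`,
since `VR_0(X)` has no edges. -/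
def fZero {X Z : Type} (dX : SymFun X) (dZ : SymFun Z) (f : X → Z) :
    H0 (VR dX 0) →ₗ[ZMod 2] H0 (VR dZ 0) :=
  H0map ⟨f, fun h => by rw [VR_zero] at h; exact h.elim⟩

/-- The dimension of the quotient `N / D` of two subspaces `D ≤ N` of a vector space. -/
def dimQuot {k V : Type} [Field k] [AddCommGroup V] [Module k V] (N D : Submodule k V) : ℕ :=
  Module.finrank k (N ⧸ D.submoduleOf N)

/-- The numerator `f_0(ker⁺_a(X)) ∩ ker⁺_b(Z)` of the block function. -/
def blockNum {X Z : Type} (dX : SymFun X) (dZ : SymFun Z) (f : X → Z) (a b : ℝ≥0) :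
    Submodule (ZMod 2) (H0 (VR dZ 0)) :=
  (kerPlus dX a).map (fZero dX dZ f) ⊓ kerPlus dZ b

/-- The denominator `f_0(ker⁻_a(X)) ∩ ker⁺_b(Z) + f_0(ker⁺_a(X)) ∩ ker⁻_b(Z)`. -/
def blockDen {X Z : Type} (dX : SymFun X) (dZ : SymFun Z) (f : X → Z) (a b : ℝ≥0) :
    Submodule (ZMod 2) (H0 (VR dZ 0)) :=
  ((kerMinus dX a).map (fZero dX dZ f) ⊓ kerPlus dZ b) ⊔
    ((kerPlus dX a).map (fZero dX dZ f) ⊓ kerMinus dZ b)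

/-- The induced block function `M_f^0(a, b)`: the dimension of numerator modulo denominator. -/
def blockFun {X Z : Type} (dX : SymFun X) (dZ : SymFun Z) (f : X → Z) (a b : ℝ≥0) : ℕ :=
  dimQuot (blockNum dX dZ f a b) (blockDen dX dZ f a b)

/-- The index set of the copies of `κ^a → κ^b`: triples of `b ∈ ℝ⁺`, `a ≥ b` and
`i ∈ {1, …, M a b}`. -/
abbrev CopyIndex (M : ℝ≥0 → ℝ≥0 → ℕ) : Type :=
  Σ b : ℝ≥0, Σ a : {a : ℝ≥0 // b ≤ a}, Fin (M a.1 b)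

/-- The pair `(a, b)` of end points of each summand: the index `none` gives `κ^∞ → κ^∞`, and the
other indices give the copies of `κ^a → κ^b`. -/
def endPoints (M : ℝ≥0 → ℝ≥0 → ℕ) : Option (CopyIndex M) → {p : ℝ≥0∞ × ℝ≥0∞ // p.2 ≤ p.1}
  | none => ⟨(∞, ∞), le_rfl⟩
  | some ⟨b, a, _⟩ => ⟨((a.1 : ℝ≥0∞), (b : ℝ≥0∞)), ENNReal.coe_le_coe.mpr a.2⟩

/-- The persistence morphism
`(⨁_b ⨁_{a ≥ b} ⨁_{i ∈ {1, …, M a b}} (κ^a → κ^b)) ⊕ (κ^∞ → κ^∞)`. -/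
def standardHom (M : ℝ≥0 → ℝ≥0 → ℕ) :
    directSum (fun i => kappa (endPoints M i).1.1) ⟶
      directSum (fun i => kappa (endPoints M i).1.2) :=
  directSumHom fun i => kappaHom (endPoints M i).2

end PersistenceMatching

end

/-!
The vector space `H₀(VR₀(Z))`, identified with `H₀(VR₀(X))` through `f₀`, carries two filtrations:
by `P a = f₀(ker⁺_a(X))` and by `Q b = ker⁺_b(Z)`.  Non-expansiveness says `P a ≤ Q a`, and both
filtrations end in the kernel of the augmentation `[z] ↦ 1`, a hyperplane.

Two filtrations of a finite-dimensional vector space always have a common adapted basis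
(`exists_adaptedBasis`).  For each `(a, b)` choose a complement `C a b` of
`(P⁻ a ⊓ Q b) ⊔ (P a ⊓ Q⁻ b)` in `P a ⊓ Q b`; its dimension is the value of the block function.
The complements are independent, by comparing lexicographic leading terms (`iSupIndep_of_compl`),
and those with `a' ≤ a`, `b' ≤ b` span `P a ⊓ Q b`, by induction on the dimensions
(`inf_le_iSup_compl`).  Since `P a ≤ Q a`, the complements with `a < b` vanish.  Bases of the others,
together with one generator outside the hyperplane, form a basis indexed by the summands of
`standardHom`.

For graphs `G ≤ H` the kernel of the map on 0-homology is spanned by the sums `[x] + [x']` of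
connected points (`ker_H0map_ofLE`).  Hence `ker⁺_r` is the kernel of the map to the 0-homology of
the threshold graph for every `r`, also `r = 0`, and the kernel of `ρ_{0r}` for `r > 0`.  As the
structure maps from the origin are surjective, an adapted basis presents the persistence module:
sending the generator of the `i`-th interval module to the `i`-th basis vector is an isomorphism
(`IsPresentedBy.isIso_hom`).  A basis adapted to both filtrations does this for the source and for
the target of the induced morphism at once, which gives the square (`nonempty_arrow_iso`).
-/

namespace PersistenceMatching

/-! ### Two filtrations of a vector space -/

section Filtration

variable {k V ι : Type} [Field k] [AddCommGroup V] [Module k V] [LinearOrder ι]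

/-- The part of a filtration strictly below an index. -/
def strictPart (P : ι → Submodule k V) (a : ι) : Submodule k V := ⨆ t, ⨆ _ : t < a, P t

theorem le_strictPart (P : ι → Submodule k V) {t a : ι} (h : t < a) : P t ≤ strictPart P a :=
  le_iSup₂_of_le t h le_rfl

theorem strictPart_le {P : ι → Submodule k V} (hP : Monotone P) (a : ι) :
    strictPart P a ≤ P a :=
  iSup₂_le fun _ h => hP h.le

theorem mem_strictPart {P : ι → Submodule k V} (hP : Monotone P) {a : ι} {v : V}
    (hv : v ∈ strictPart P a) : v = 0 ∨ ∃ t < a, v ∈ P t := by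
  rw [strictPart, iSup_subtype'] at hv
  rcases isEmpty_or_nonempty {t // t < a} with h | h
  · left
    rwa [iSup_of_empty, Submodule.mem_bot] at hv
  · right
    have hd : Directed (· ≤ ·) fun t : {t // t < a} => P t :=
      Monotone.directed_le fun s t hst => hP hst
    obtain ⟨⟨t, ht⟩, hvt⟩ := (Submodule.mem_iSup_of_directed _ hd).1 hv
    exact ⟨t, ht, hvt⟩

/-- For a linearly ordered family of submodules it suffices, for independence, that each one is
disjoint from the span of the smaller ones: look at the largest index occurring in a relation. -/
theorem iSupIndep_of_disjoint_lt (C : ι → Submodule k V)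
    (h : ∀ i, Disjoint (C i) (⨆ j, ⨆ _ : j < i, C j)) : iSupIndep C := by
  classical
  apply iSupIndep_of_dfinsupp_lsum_injective
  rw [← LinearMap.ker_eq_bot, LinearMap.ker_eq_bot']
  intro x hx
  by_contra hne
  have hs : x.support.Nonempty := by
    rw [Finset.nonempty_iff_ne_empty]
    exact fun h0 => hne (DFinsupp.support_eq_empty.1 h0)
  have hi := x.support.max'_mem hs
  set i := x.support.max' hs with hidef
  have hsum : ∑ j ∈ x.support, (x j : V) = 0 := by
    rw [DFinsupp.lsum_apply_apply, DFinsupp.sumAddHom_apply] at hx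
    simpa [DFinsupp.sum] using hx
  rw [← Finset.add_sum_erase _ _ hi] at hsum
  have hmem : (x i : V) ∈ ⨆ j, ⨆ _ : j < i, C j := by
    rw [eq_neg_of_add_eq_zero_left hsum]
    refine Submodule.neg_mem _ (Submodule.sum_mem _ fun j hj => ?_)
    have hji : j < i := lt_of_le_of_ne
      (x.support.le_max' j (Finset.mem_of_mem_erase hj)) (Finset.ne_of_mem_erase hj)
    exact (le_iSup₂_of_le j hji le_rfl : C j ≤ _) (x j).2
  have h0 := Submodule.disjoint_def.1 (h i) _ (x i).2 hmem
  exact (DFinsupp.mem_support_iff.1 hi) (Subtype.ext h0)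

/-- The part of `P a ⊓ Q b` which already occurs in `P t ⊓ Q b` with `t < a` or in `P a ⊓ Q t`
with `t < b`. -/
def doublePart (P Q : ι → Submodule k V) (a b : ι) : Submodule k V :=
  (strictPart P a ⊓ Q b) ⊔ (P a ⊓ strictPart Q b)

theorem doublePart_le {P Q : ι → Submodule k V} (hP : Monotone P) (hQ : Monotone Q) (a b : ι) :
    doublePart P Q a b ≤ P a ⊓ Q b :=
  sup_le (inf_le_inf_right _ (strictPart_le hP a)) (inf_le_inf_left _ (strictPart_le hQ b))

/-- The lexicographic order on `(a, b)` reduces independence to a comparison of each complement with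
the lexicographically smaller ones. -/
theorem iSupIndep_of_compl {P Q : ι → Submodule k V} (hQ : Monotone Q)
    (C : ι → ι → Submodule k V) (hC : ∀ a b, C a b ⊔ doublePart P Q a b = P a ⊓ Q b)
    (hd : ∀ a b, Disjoint (C a b) (doublePart P Q a b)) :
    iSupIndep fun p : ι ×ₗ ι => C (ofLex p).1 (ofLex p).2 := by
  have hle : ∀ a b, C a b ≤ P a ⊓ Q b := fun a b => le_sup_left.trans (hC a b).le
  apply iSupIndep_of_disjoint_lt
  intro p
  obtain ⟨a, b⟩ := p
  have hlow : (⨆ q : ι ×ₗ ι, ⨆ _ : q < toLex (a, b), C (ofLex q).1 (ofLex q).2) ≤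
      strictPart P a ⊔ (P a ⊓ strictPart Q b) := by
    refine iSup₂_le fun q hq => ?_
    rcases Prod.Lex.lt_iff.1 hq with h | ⟨h, h'⟩
    · exact (hle _ _).trans (inf_le_left.trans ((le_strictPart P h).trans le_sup_left))
    · refine (hle _ _).trans (le_trans ?_ le_sup_right)
      exact inf_le_inf (by rw [h]; exact le_rfl) (le_strictPart Q h')
  refine Disjoint.mono_right hlow (Submodule.disjoint_def.2 fun v hv hv' => ?_)
  refine Submodule.disjoint_def.1 (hd a b) v hv ?_
  obtain ⟨u, hu, w, hw, rfl⟩ := Submodule.mem_sup.1 hv'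
  have hwQ : w ∈ Q b := strictPart_le hQ b hw.2
  have huQ : u ∈ Q b := by
    simpa using (Q b).sub_mem (hle a b hv).2 hwQ
  exact Submodule.add_mem_sup ⟨hu, huQ⟩ hw

/-- A filtration that takes all its values on a finite set of indices attains each value at a
smallest index. -/
theorem exists_minimal_index {P : ι → Submodule k V} (hP : Monotone P) {S : Set ι}
    (hS : S.Finite) (hPS : ∀ a, ∃ s ∈ S, s ≤ a ∧ P s = P a) (a : ι) :
    ∃ s ≤ a, P s = P a ∧ ∀ t < s, P t < P s := by
  obtain ⟨s₀, hs₀, hs₀a, hPs₀⟩ := hPS a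
  obtain ⟨s, ⟨hsS, hsa, hPs⟩, hmin⟩ := Set.exists_min_image {s | s ∈ S ∧ s ≤ a ∧ P s = P a} id
    (hS.subset fun s hs => hs.1) ⟨s₀, hs₀, hs₀a, hPs₀⟩
  refine ⟨s, hsa, hPs, fun t hts => lt_of_le_of_ne (hP hts.le) fun hPt => ?_⟩
  obtain ⟨r, hr, hrt, hPr⟩ := hPS t
  exact (hts.trans_le (hmin r ⟨hr, (hrt.trans hts.le).trans hsa, hPr.trans (hPt.trans hPs)⟩)).not_ge
    hrt

/-- By induction, `P a ⊓ Q b` is the sum of a complement and of pieces `P t ⊓ Q b` with `t < a` and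
`P a ⊓ Q t` with `t < b`, which are handled already.  The finiteness of the sets of jumps makes the
induction terminate. -/
theorem inf_le_iSup_compl [FiniteDimensional k V] {P Q : ι → Submodule k V} (hP : Monotone P)
    (hQ : Monotone Q) {S T : Set ι} (hS : S.Finite) (hPS : ∀ a, ∃ s ∈ S, s ≤ a ∧ P s = P a)
    (hT : T.Finite) (hQT : ∀ a, ∃ s ∈ T, s ≤ a ∧ Q s = Q a)
    (C : ι → ι → Submodule k V) (hC : ∀ a b, C a b ⊔ doublePart P Q a b = P a ⊓ Q b) (a b : ι) :
    P a ⊓ Q b ≤ ⨆ a', ⨆ b', ⨆ _ : a' ≤ a ∧ b' ≤ b, C a' b' := by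
  induction hn : Module.finrank k (P a) + Module.finrank k (Q b) using Nat.strong_induction_on
    generalizing a b with
  | _ n ih =>
  -- Lowering `a` and `b` to the smallest indices with the same subspaces makes every strictly
  -- smaller index decrease the dimension.
  obtain ⟨s, hsa, hPs, hs⟩ := exists_minimal_index hP hS hPS a
  obtain ⟨t, htb, hQt, ht⟩ := exists_minimal_index hQ hT hQT b
  have hmono : ∀ a' b', a' ≤ a → b' ≤ b → (⨆ a'', ⨆ b'', ⨆ _ : a'' ≤ a' ∧ b'' ≤ b', C a'' b'') ≤
      ⨆ a'', ⨆ b'', ⨆ _ : a'' ≤ a ∧ b'' ≤ b, C a'' b'' := fun a' b' ha hb =>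
    iSup_mono fun a'' => iSup_mono fun b'' => iSup_le fun h =>
      le_iSup_of_le ⟨h.1.trans ha, h.2.trans hb⟩ le_rfl
  rw [← hPs, ← hQt] at hn ⊢
  rw [← hC s t]
  refine sup_le (le_iSup_of_le s (le_iSup_of_le t (le_iSup_of_le ⟨hsa, htb⟩ le_rfl))) (sup_le ?_ ?_)
  · rintro v ⟨hv, hvQ⟩
    rcases mem_strictPart hP hv with rfl | ⟨r, hr, hvr⟩
    · exact Submodule.zero_mem _
    · have := Submodule.finrank_lt_finrank_of_lt (hs r hr)
      exact hmono r t (hr.le.trans hsa) htb (ih _ (by omega) r t rfl ⟨hvr, hvQ⟩)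
  · rintro v ⟨hvP, hv⟩
    rcases mem_strictPart hQ hv with rfl | ⟨r, hr, hvr⟩
    · exact Submodule.zero_mem _
    · have := Submodule.finrank_lt_finrank_of_lt (ht r hr)
      exact hmono s r hsa (hr.le.trans htb) (ih _ (by omega) s r rfl ⟨hvP, hvr⟩)

theorem exists_compl_dimQuot [FiniteDimensional k V] {N D : Submodule k V} (h : D ≤ N) :
    ∃ C : Submodule k V, C ⊔ D = N ∧ Disjoint C D ∧ Module.finrank k C = dimQuot N D := by
  obtain ⟨C, hC⟩ := Submodule.exists_isCompl (D.submoduleOf N)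
  have hD : (D.submoduleOf N).map N.subtype = D := by
    rw [Submodule.submoduleOf, Submodule.map_comap_subtype, inf_eq_right.2 h]
  refine ⟨C.map N.subtype, ?_, ?_, ?_⟩
  · conv_lhs => rw [← hD]
    rw [← Submodule.map_sup, hC.symm.sup_eq_top, Submodule.map_subtype_top]
  · rw [← hD]
    exact (Submodule.disjoint_map N.subtype_injective hC.symm.disjoint)
  · rw [dimQuot, (Submodule.quotientEquivOfIsCompl _ C hC).finrank_eq]
    exact Submodule.finrank_map_subtype_eq N C

theorem span_range_coe_basis {α : Type} {C : Submodule k V} (c : Module.Basis α k C) :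
    Submodule.span k (Set.range fun i => (c i : V)) = C := by
  have : (Set.range fun i => (c i : V)) = C.subtype '' Set.range c := by
    rw [← Set.range_comp]; rfl
  rw [this, Submodule.span_image, c.span_eq, Submodule.map_subtype_top]

theorem linearIndependent_of_iSupIndep {κ : Type} {α : κ → Type} {C : κ → Submodule k V}
    (hC : iSupIndep C) (c : ∀ p, Module.Basis (α p) k (C p)) :
    LinearIndependent k fun q : Σ p, α p => (c q.1 q.2 : V) := by
  refine linearIndependent_iUnion_finite (f := fun p i => (c p i : V)) (fun p => ?_)
    fun p t _ hpt => ?_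
  · exact (c p).linearIndependent.map' _ (Submodule.ker_subtype _)
  · simp only [span_range_coe_basis]
    exact hC.disjoint_biSup hpt

/-- Two filtrations `P ≤ Q` of a vector space `V`, both exhausting the same hyperplane `U`, have a
common adapted basis: the vectors in `P a` or in `Q b` are those spanned by the basis vectors with
first, respectively second, end point at most `a` or `b`, and the number of basis vectors with end
points `(a, b)` is the dimension of `P a ⊓ Q b` modulo `doublePart P Q a b`.  The index `none`, with
end points `(∞, ∞)`, stands for a vector outside `U`. -/
theorem exists_adaptedBasis [FiniteDimensional k V] {P Q : ℝ≥0 → Submodule k V} (hP : Monotone P)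
    (hQ : Monotone Q) (hPQ : ∀ a, P a ≤ Q a)
    {S T : Set ℝ≥0} (hS : S.Finite) (hPS : ∀ a, ∃ s ∈ S, s ≤ a ∧ P s = P a)
    (hT : T.Finite) (hQT : ∀ a, ∃ s ∈ T, s ≤ a ∧ Q s = Q a)
    {U : Submodule k V} (hPU : ∀ a, P a ≤ U) (hQU : ∀ a, Q a ≤ U)
    {R R' : ℝ≥0} (hPR : P R = U) (hQR : Q R' = U)
    {u : V} (hu : u ∉ U) (hUu : U ⊔ Submodule.span k {u} = ⊤)
    {M : ℝ≥0 → ℝ≥0 → ℕ} (hM : ∀ a b, M a b = dimQuot (P a ⊓ Q b) (doublePart P Q a b)) :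
    ∃ e : Module.Basis (Option (CopyIndex M)) k V,
      (∀ a : ℝ≥0, P a = Submodule.span k (e '' {i | (endPoints M i).1.1 ≤ a})) ∧
      ∀ b : ℝ≥0, Q b = Submodule.span k (e '' {i | (endPoints M i).1.2 ≤ b}) := by
  choose C hC hd hdim using fun a b => exists_compl_dimQuot (doublePart_le hP hQ a b)
  have hle : ∀ a b, C a b ≤ P a ⊓ Q b := fun a b => le_sup_left.trans (hC a b).le
  -- For `a < b` there is no block, since `P a ⊓ Q b = P a` is contained in `Q a`.
  have hbot : ∀ a b, a < b → C a b = ⊥ := fun a b hab => by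
    refine (hd a b).eq_bot_of_le ((hle a b).trans (le_trans ?_ le_sup_right))
    exact le_inf inf_le_left (inf_le_left.trans ((hPQ a).trans (le_strictPart Q hab)))
  have hrank : ∀ a b, Module.finrank k (C a b) = M a b := fun a b => by rw [hdim, hM]
  have c : ∀ a b, Module.Basis (Fin (M a b)) k (C a b) := fun a b =>
    Module.finBasisOfFinrankEq k (C a b) (hrank a b)
  let g : CopyIndex M → V := fun i => (c i.2.1.1 i.1 i.2.2 : V)
  have hindep : LinearIndependent k g := by
    have h1 : iSupIndep fun p : (Σ b : ℝ≥0, {a : ℝ≥0 // b ≤ a}) => C p.2.1 p.1 := by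
      refine (iSupIndep_of_compl hQ C hC hd).comp
        (f := fun p : (Σ b : ℝ≥0, {a : ℝ≥0 // b ≤ a}) => toLex (p.2.1, p.1)) ?_
      rintro ⟨b, a, h⟩ ⟨b', a', h'⟩ heq
      obtain ⟨rfl, rfl⟩ := Prod.mk.inj (toLex.injective heq)
      rfl
    have h2 : LinearIndependent k
        fun q : (Σ p : (Σ b : ℝ≥0, {a : ℝ≥0 // b ≤ a}), Fin (M p.2.1 p.1)) =>
          (c q.1.2.1 q.1.1 q.2 : V) := linearIndependent_of_iSupIndep h1 fun p => c p.2.1 p.1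
    rw [← linearIndependent_equiv (Equiv.sigmaAssoc _)]
    exact h2
  have hblock : ∀ a b {s : Set (CopyIndex M)},
      (∀ h : b ≤ a, ∀ i, (⟨b, ⟨a, h⟩, i⟩ : CopyIndex M) ∈ s) →
      C a b ≤ Submodule.span k (g '' s) := fun a b s hs => by
    rcases lt_or_ge a b with hab | hab
    · rw [hbot a b hab]
      exact bot_le
    · rw [← span_range_coe_basis (c a b), Submodule.span_le]
      rintro _ ⟨i, rfl⟩
      exact Submodule.subset_span ⟨⟨b, ⟨a, hab⟩, i⟩, hs hab i, rfl⟩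
  have hPspan : ∀ a, P a = Submodule.span k (g '' {i | i.2.1.1 ≤ a}) := fun a => by
    apply le_antisymm
    · calc P a ≤ P a ⊓ Q R' := le_inf le_rfl ((hPU a).trans hQR.ge)
        _ ≤ _ := inf_le_iSup_compl hP hQ hS hPS hT hQT C hC a R'
        _ ≤ _ := iSup_le fun a' => iSup_le fun b' => iSup_le fun h =>
          hblock a' b' fun _ _ => h.1
    · rw [Submodule.span_le]
      rintro _ ⟨i, hi, rfl⟩
      exact hP hi (hle _ _ (c i.2.1.1 i.1 i.2.2).2).1
  have hQspan : ∀ b, Q b = Submodule.span k (g '' {i | i.1 ≤ b}) := fun b => by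
    apply le_antisymm
    · calc Q b ≤ P R ⊓ Q b := le_inf ((hQU b).trans hPR.ge) le_rfl
        _ ≤ _ := inf_le_iSup_compl hP hQ hS hPS hT hQT C hC R b
        _ ≤ _ := iSup_le fun a' => iSup_le fun b' => iSup_le fun h =>
          hblock a' b' fun _ _ => h.2
    · rw [Submodule.span_le]
      rintro _ ⟨i, hi, rfl⟩
      exact hQ hi (hle _ _ (c i.2.1.1 i.1 i.2.2).2).2
  have hrange : Submodule.span k (Set.range g) = U := by
    apply le_antisymm
    · rw [Submodule.span_le]
      rintro _ ⟨i, rfl⟩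
      exact hPU _ (hle _ _ (c i.2.1.1 i.1 i.2.2).2).1
    · rw [← hPR, hPspan R]
      exact Submodule.span_mono (Set.image_subset_range _ _)
  let g' : Option (CopyIndex M) → V := fun o => o.elim u g
  have hg' : LinearIndependent k g' :=
    linearIndependent_option.2 ⟨hindep, by
      change u ∉ Submodule.span k (Set.range g)
      rwa [hrange]⟩
  have htop : ⊤ ≤ Submodule.span k (Set.range g') := by
    rw [← hUu, ← hrange, sup_le_iff, Submodule.span_le, Submodule.span_le]
    refine ⟨?_, ?_⟩
    · rintro _ ⟨i, rfl⟩
      exact Submodule.subset_span ⟨some i, rfl⟩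
    · rintro _ rfl
      exact Submodule.subset_span ⟨none, rfl⟩
  refine ⟨Module.Basis.mk hg' htop, fun a => ?_, fun b => ?_⟩
  · rw [hPspan a, Module.Basis.coe_mk]
    congr 1
    ext v
    constructor
    · rintro ⟨i, hi, rfl⟩
      exact ⟨some i, ENNReal.coe_le_coe.2 hi, rfl⟩
    · rintro ⟨_ | i, hi, rfl⟩
      · exact (ENNReal.coe_ne_top (top_le_iff.1 hi)).elim
      · exact ⟨i, ENNReal.coe_le_coe.1 hi, rfl⟩
  · rw [hQspan b, Module.Basis.coe_mk]
    congr 1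
    ext v
    constructor
    · rintro ⟨i, hi, rfl⟩
      exact ⟨some i, ENNReal.coe_le_coe.2 hi, rfl⟩
    · rintro ⟨_ | i, hi, rfl⟩
      · exact (ENNReal.coe_ne_top (top_le_iff.1 hi)).elim
      · exact ⟨i, ENNReal.coe_le_coe.1 hi, rfl⟩

end Filtration

/-! ### Kernels of the maps on 0-homology -/

section Graph

variable {X Z : Type}

theorem H0map_cls {G : SimpleGraph X} {H : SimpleGraph Z} (φ : G →g H) (x : X) :
    H0map φ (cls G x) = cls H (φ x) := by
  simp [H0map, cls]

theorem H0_hom_ext {G : SimpleGraph X} {E : Type} [AddCommGroup E] [Module (ZMod 2) E]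
    {φ ψ : H0 G →ₗ[ZMod 2] E} (h : ∀ x, φ (cls G x) = ψ (cls G x)) : φ = ψ := by
  apply Finsupp.lhom_ext'
  intro c
  induction c using SimpleGraph.ConnectedComponent.ind with
  | h x => exact LinearMap.ext_ring (h x)

theorem H0map_surjective {G : SimpleGraph X} {H : SimpleGraph Z} (φ : G →g H)
    (hφ : Function.Surjective φ) : Function.Surjective (H0map φ) := by
  refine Finsupp.mapDomain_surjective fun c => ?_
  induction c using SimpleGraph.ConnectedComponent.ind with
  | h z =>
    obtain ⟨x, rfl⟩ := hφ z
    exact ⟨G.connectedComponentMk x, rfl⟩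

theorem cls_eq_cls {G : SimpleGraph X} {x y : X} (h : G.Reachable x y) : cls G x = cls G y := by
  rw [cls, cls, SimpleGraph.ConnectedComponent.sound h]

theorem add_self_eq_zero_of_zmod_two {E : Type} [AddCommGroup E] [Module (ZMod 2) E] (v : E) :
    v + v = 0 := by
  rw [← two_smul (ZMod 2) v, show (2 : ZMod 2) = 0 from rfl, zero_smul]

/-- The span of the sums `[x] + [x']` over pairs of points connected in the larger graph `H`. -/
noncomputable def reachSpan (G H : SimpleGraph X) : Submodule (ZMod 2) (H0 G) :=
  Submodule.span (ZMod 2) {v | ∃ x x', H.Reachable x x' ∧ v = cls G x + cls G x'}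

theorem reachSpan_mono (G : SimpleGraph X) {H H' : SimpleGraph X} (h : H ≤ H') :
    reachSpan G H ≤ reachSpan G H' := by
  refine Submodule.span_mono ?_
  rintro _ ⟨x, x', hx, rfl⟩
  exact ⟨x, x', hx.mono h, rfl⟩

/-- Sending each component of `H` to the class of a representative gives a section of the map to
`H0 H`; modulo `reachSpan G H` the composite with this section is the identity. -/
theorem ker_H0map_ofLE {G H : SimpleGraph X} (h : G ≤ H) :
    LinearMap.ker (H0map (SimpleGraph.Hom.ofLE h)) = reachSpan G H := by
  apply le_antisymm
  · intro v hv
    let s : H0 H →ₗ[ZMod 2] H0 G :=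
      Finsupp.lift (H0 G) (ZMod 2) H.ConnectedComponent fun c => cls G c.out
    have hs : ∀ x, s (cls H x) = cls G (H.connectedComponentMk x).out := fun x => by
      simp [s, cls]
    have key : (reachSpan G H).mkQ ∘ₗ (s ∘ₗ H0map (SimpleGraph.Hom.ofLE h)) =
        (reachSpan G H).mkQ := by
      refine H0_hom_ext fun x => ?_
      rw [LinearMap.comp_apply, LinearMap.comp_apply, H0map_cls, hs]
      refine (Submodule.Quotient.eq _).2 ?_
      refine Submodule.subset_span ⟨(H.connectedComponentMk x).out, x, ?_, ?_⟩
      · exact SimpleGraph.ConnectedComponent.exact (Quot.out_eq (H.connectedComponentMk x))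
      · rw [sub_eq_iff_eq_add, add_assoc, add_self_eq_zero_of_zmod_two, add_zero]
        rfl
    have := LinearMap.congr_fun key v
    rw [LinearMap.comp_apply, LinearMap.comp_apply, LinearMap.mem_ker.1 hv, map_zero,
      map_zero] at this
    exact (Submodule.Quotient.mk_eq_zero _).1 this.symm
  · refine Submodule.span_le.2 ?_
    rintro _ ⟨x, x', hx, rfl⟩
    rw [SetLike.mem_coe, LinearMap.mem_ker, map_add, H0map_cls, H0map_cls]
    change cls H x + cls H x' = 0
    rw [cls_eq_cls hx, add_self_eq_zero_of_zmod_two]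

theorem thresholdGraph_mono (d : SymFun X) : Monotone (thresholdGraph d) :=
  fun _ _ h _ _ hxy => ⟨hxy.1, hxy.2.trans h⟩

theorem ker_rho_of_ne_zero (d : SymFun X) {r : ℝ≥0} (hr : r ≠ 0) :
    LinearMap.ker (rho d (zero_le (a := r))) = reachSpan (VR d 0) (thresholdGraph d r) := by
  rw [rho, ker_H0map_ofLE]
  congr 1
  exact if_neg hr

/-- At `r = 0` the threshold graph, unlike `VR d 0`, has the edges at value `0`; with it the two cases
in the definition of `ker⁺` agree. -/
theorem kerPlus_eq (d : SymFun X) (r : ℝ≥0) :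
    kerPlus d r = reachSpan (VR d 0) (thresholdGraph d r) := by
  unfold kerPlus
  split_ifs with h
  · rw [h, reachSpan]
  · exact ker_rho_of_ne_zero d h

theorem kerPlus_mono (d : SymFun X) : Monotone (kerPlus d) := fun r s h => by
  rw [kerPlus_eq, kerPlus_eq]
  exact reachSpan_mono _ (thresholdGraph_mono d h)

theorem ker_rho_zero (d : SymFun X) :
    LinearMap.ker (rho d (zero_le (a := (0 : ℝ≥0)))) = ⊥ := by
  rw [rho_refl, LinearMap.ker_id]

theorem kerMinus_eq (d : SymFun X) (b : ℝ≥0) : kerMinus d b = strictPart (kerPlus d) b := by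
  apply le_antisymm
  · refine iSup₂_le fun r hr => ?_
    by_cases h : r = 0
    · subst h
      rw [ker_rho_zero]
      exact bot_le
    · rw [ker_rho_of_ne_zero d h, ← kerPlus_eq]
      exact le_strictPart _ hr
  · refine iSup₂_le fun r hr => ?_
    -- The index `r` may be `0`, where `ker ρ_{00} = 0` is smaller than `ker⁺_0`; some strictly
    -- larger index below `b` takes its place.
    obtain ⟨s, hrs, hsb⟩ := exists_between hr
    refine (kerPlus_mono d hrs.le).trans (le_iSup₂_of_le s hsb ?_)
    rw [kerPlus_eq, ker_rho_of_ne_zero d (bot_le.trans_lt hrs).ne']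

/-- The filtration by `ker⁺` jumps only at `0` and at the values of `d`. -/
theorem exists_finite_kerPlus_eq [Finite X] (d : SymFun X) :
    ∃ S : Set ℝ≥0, S.Finite ∧ ∀ a, ∃ s ∈ S, s ≤ a ∧ kerPlus d s = kerPlus d a := by
  have hfin : (insert 0 (Set.range fun p : X × X => d.dist p.1 p.2)).Finite :=
    (Set.finite_range _).insert 0
  refine ⟨_, hfin, fun a => ?_⟩
  obtain ⟨s, ⟨hsS, hsa⟩, hmax⟩ := Set.exists_max_image
    {s | s ∈ insert 0 (Set.range fun p : X × X => d.dist p.1 p.2) ∧ s ≤ a} id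
    (hfin.subset fun s hs => hs.1) ⟨0, Set.mem_insert _ _, zero_le⟩
  refine ⟨s, hsS, hsa, ?_⟩
  rw [kerPlus_eq, kerPlus_eq]
  congr 1
  apply le_antisymm (thresholdGraph_mono d hsa)
  exact fun x y hxy => ⟨hxy.1, hmax _ ⟨Set.mem_insert_of_mem _ ⟨(x, y), rfl⟩, hxy.2⟩⟩

/-- The augmentation `[x] ↦ 1`. -/
noncomputable def augmentation (G : SimpleGraph X) : H0 G →ₗ[ZMod 2] ZMod 2 :=
  Finsupp.lift (ZMod 2) (ZMod 2) G.ConnectedComponent fun _ => 1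

theorem augmentation_cls (G : SimpleGraph X) (x : X) : augmentation G (cls G x) = 1 := by
  simp [augmentation, cls]

theorem reachSpan_le_ker_augmentation (G H : SimpleGraph X) :
    reachSpan G H ≤ LinearMap.ker (augmentation G) := by
  refine Submodule.span_le.2 ?_
  rintro _ ⟨x, x', -, rfl⟩
  rw [SetLike.mem_coe, LinearMap.mem_ker, map_add, augmentation_cls, augmentation_cls]
  rfl

theorem kerPlus_le_ker_augmentation (d : SymFun X) (r : ℝ≥0) :
    kerPlus d r ≤ LinearMap.ker (augmentation (VR d 0)) := by
  rw [kerPlus_eq]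
  exact reachSpan_le_ker_augmentation _ _

theorem sub_augmentation_smul_mem {G H : SimpleGraph X} {x₀ : X} (h : ∀ x, H.Reachable x x₀)
    (v : H0 G) : v - augmentation G v • cls G x₀ ∈ reachSpan G H := by
  have key : (reachSpan G H).mkQ =
      (reachSpan G H).mkQ ∘ₗ ((augmentation G).smulRight (cls G x₀)) := by
    refine H0_hom_ext fun x => ?_
    rw [LinearMap.comp_apply, LinearMap.smulRight_apply, augmentation_cls, one_smul]
    refine (Submodule.Quotient.eq _).2 (Submodule.subset_span ⟨x, x₀, h x, ?_⟩)
    rw [sub_eq_iff_eq_add, add_assoc, add_self_eq_zero_of_zmod_two, add_zero]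
  exact (Submodule.Quotient.eq _).1 (LinearMap.congr_fun key v)

theorem exists_dist_le [Finite X] (d : SymFun X) : ∃ R, ∀ x y, d.dist x y ≤ R := by
  obtain ⟨R, hR⟩ := (Set.finite_range fun p : X × X => d.dist p.1 p.2).bddAbove
  exact ⟨R, fun x y => hR ⟨(x, y), rfl⟩⟩

theorem thresholdGraph_reachable {d : SymFun X} {R : ℝ≥0} (hR : ∀ x y, d.dist x y ≤ R) (x y : X) :
    (thresholdGraph d R).Reachable x y := by
  by_cases h : x = y
  · rw [h]
  · exact SimpleGraph.Adj.reachable ⟨h, hR x y⟩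

theorem kerPlus_eq_ker_augmentation [Nonempty X] {d : SymFun X} {R : ℝ≥0}
    (hR : ∀ x y, d.dist x y ≤ R) : kerPlus d R = LinearMap.ker (augmentation (VR d 0)) := by
  refine le_antisymm (kerPlus_le_ker_augmentation d R) fun v hv => ?_
  obtain ⟨x₀⟩ := ‹Nonempty X›
  have := sub_augmentation_smul_mem (H := thresholdGraph d R)
    (fun x => thresholdGraph_reachable hR x x₀) v
  rwa [LinearMap.mem_ker.1 hv, zero_smul, sub_zero, ← kerPlus_eq] at this

theorem ker_augmentation_sup_span (G : SimpleGraph X) (x : X) :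
    LinearMap.ker (augmentation G) ⊔ Submodule.span (ZMod 2) {cls G x} = ⊤ := by
  refine eq_top_iff.2 fun v _ => ?_
  rw [← sub_add_cancel v (augmentation G v • cls G x)]
  refine Submodule.add_mem_sup ?_ (Submodule.smul_mem _ _ (Submodule.mem_span_singleton_self _))
  rw [LinearMap.mem_ker, map_sub, map_smul, augmentation_cls, smul_eq_mul, mul_one, sub_self]

theorem fZero_cls (dX : SymFun X) (dZ : SymFun Z) (f : X → Z) (x : X) :
    fZero dX dZ f (cls (VR dX 0) x) = cls (VR dZ 0) (f x) :=
  H0map_cls _ x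

/-- The isomorphism `[x] ↦ [f x]` given by a bijection `f`. -/
noncomputable def fZeroEquiv (dX : SymFun X) (dZ : SymFun Z) (f : X ≃ Z) :
    H0 (VR dX 0) ≃ₗ[ZMod 2] H0 (VR dZ 0) :=
  LinearEquiv.ofLinearMap (fZero dX dZ f) (fZero dZ dX f.symm)
    (H0_hom_ext fun z => by simp [fZero_cls]) (H0_hom_ext fun x => by simp [fZero_cls])

theorem augmentation_fZero (dX : SymFun X) (dZ : SymFun Z) (f : X → Z) :
    augmentation (VR dZ 0) ∘ₗ fZero dX dZ f = augmentation (VR dX 0) :=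
  H0_hom_ext fun x => by simp [fZero_cls, augmentation_cls]

theorem map_ker_augmentation (dX : SymFun X) (dZ : SymFun Z) (f : X ≃ Z) :
    (LinearMap.ker (augmentation (VR dX 0))).map (fZero dX dZ f) =
      LinearMap.ker (augmentation (VR dZ 0)) := by
  rw [← augmentation_fZero dX dZ f, LinearMap.ker_comp]
  exact Submodule.map_comap_eq_of_surjective (fZeroEquiv dX dZ f).surjective _

/-- A non-expansive injection is a map of threshold graphs. -/
def thresholdHom {dX : SymFun X} {dZ : SymFun Z} {f : X ≃ Z} (hf : NonExpansive dX dZ f)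
    (r : ℝ≥0) : thresholdGraph dX r →g thresholdGraph dZ r :=
  ⟨f, fun {x y} h => ⟨fun he => h.1 (f.injective he), (hf x y).trans h.2⟩⟩

theorem map_kerPlus_le {dX : SymFun X} {dZ : SymFun Z} {f : X ≃ Z} (hf : NonExpansive dX dZ f)
    (r : ℝ≥0) : (kerPlus dX r).map (fZero dX dZ f) ≤ kerPlus dZ r := by
  rw [kerPlus_eq, kerPlus_eq, reachSpan, Submodule.map_span, Submodule.span_le]
  rintro _ ⟨_, ⟨x, x', h, rfl⟩, rfl⟩
  rw [map_add, fZero_cls, fZero_cls]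
  exact Submodule.subset_span ⟨f x, f x', h.map (thresholdHom hf r), rfl⟩

end Graph

/-! ### Persistence modules with a basis at the origin -/

section Decomposition

theorem coe_idOrZero_smul {A B : Submodule (ZMod 2) (ZMod 2)} {E : Type} [AddCommGroup E]
    [Module (ZMod 2) E] (hBA : B ≤ A) {w : E} (hw : B = ⊥ → w = 0) (c : A) :
    (idOrZero A B c : ZMod 2) • w = (c : ZMod 2) • w := by
  rcases eq_bot_or_eq_top B with h | h
  · rw [hw h, smul_zero, smul_zero]
  · obtain rfl : A = B := le_antisymm (h ▸ le_top) hBA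
    rw [idOrZero_self, LinearMap.id_apply]

/-- The linear combination `(c i) ↦ ∑ i, c i • e i` with coefficients restricted to the subspaces
`A i` of `ℤ/2`. -/
noncomputable def combine {ι V : Type} [AddCommGroup V] [Module (ZMod 2) V]
    (A : ι → Submodule (ZMod 2) (ZMod 2)) (e : ι → V) : (⨁ i, A i) →ₗ[ZMod 2] V := by
  classical
  exact DirectSum.toModule (ZMod 2) ι V fun i =>
    LinearMap.toSpanSingleton (ZMod 2) V (e i) ∘ₗ (A i).subtype

theorem combine_lof {ι V : Type} [DecidableEq ι] [AddCommGroup V] [Module (ZMod 2) V]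
    (A : ι → Submodule (ZMod 2) (ZMod 2)) (e : ι → V) (i : ι) (c : A i) :
    combine A e (DirectSum.lof (ZMod 2) ι (fun i => A i) i c) = (c : ZMod 2) • e i := by
  obtain rfl : ‹DecidableEq ι› = fun a b => Classical.propDecidable (a = b) :=
    Subsingleton.elim _ _
  classical
  exact DirectSum.toModule_lof (M := fun i => A i)
    (φ := fun i => LinearMap.toSpanSingleton (ZMod 2) V (e i) ∘ₗ (A i).subtype) (ZMod 2) i c

theorem map_combine {ι V W : Type} [AddCommGroup V] [Module (ZMod 2) V] [AddCommGroup W]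
    [Module (ZMod 2) W] (A : ι → Submodule (ZMod 2) (ZMod 2)) (e : ι → V)
    (φ : V →ₗ[ZMod 2] W) (x : ⨁ i, A i) :
    φ (combine A e x) = combine A (fun i => φ (e i)) x := by
  classical
  have h : φ ∘ₗ combine A e = combine A fun i => φ (e i) := by
    refine DirectSum.linearMap_ext _ fun i => LinearMap.ext fun c => ?_
    simp only [LinearMap.comp_apply, combine_lof, map_smul]
  exact LinearMap.congr_fun h x

theorem repr_combine {ι V : Type} [AddCommGroup V] [Module (ZMod 2) V]
    (A : ι → Submodule (ZMod 2) (ZMod 2)) (e : Module.Basis ι (ZMod 2) V) (x : ⨁ i, A i) (i : ι) :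
    e.repr (combine A e x) i = (x i : ZMod 2) := by
  classical
  have h : (Finsupp.lapply i ∘ₗ e.repr.toLinearMap) ∘ₗ combine A e =
      (A i).subtype ∘ₗ DirectSum.component (ZMod 2) ι (fun i => A i) i := by
    refine DirectSum.linearMap_ext _ fun j => LinearMap.ext fun c => ?_
    simp only [LinearMap.comp_apply, combine_lof]
    by_cases hij : j = i
    · subst hij
      simp [DirectSum.component.lof_self]
    · simp [DirectSum.component.of, hij]
  exact LinearMap.congr_fun h x

/-- Dropping the coefficients outside `B i` changes nothing after a map that kills the corresponding
vectors.  This one computation gives both the naturality of `IsPresentedBy.hom` and the commutative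
square in `nonempty_arrow_iso`. -/
theorem map_combine_lmap {ι V W : Type} [AddCommGroup V] [Module (ZMod 2) V] [AddCommGroup W]
    [Module (ZMod 2) W] {A B : ι → Submodule (ZMod 2) (ZMod 2)} (hBA : ∀ i, B i ≤ A i)
    {e : ι → V} {ρ : V →ₗ[ZMod 2] W} (h : ∀ i, B i = ⊥ → ρ (e i) = 0) :
    ρ ∘ₗ combine B e ∘ₗ DirectSum.lmap (fun i => idOrZero (A i) (B i)) = ρ ∘ₗ combine A e := by
  classical
  refine DirectSum.linearMap_ext _ fun i => LinearMap.ext fun c => ?_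
  simp only [LinearMap.comp_apply, DirectSum.lmap_lof, combine_lof, map_smul]
  exact coe_idOrZero_smul (hBA i) (h i) c

/-- The structure map `ρ_{0r}` of a persistence module. -/
def fromZero (E : PersMod) (r : ℝ≥0) : E.obj 0 →ₗ[ZMod 2] E.obj r :=
  (E.map (homOfLE (zero_le (a := r)))).hom

theorem map_fromZero (E : PersMod) {r s : ℝ≥0} (g : r ⟶ s) (v : E.obj 0) :
    (E.map g).hom (fromZero E r v) = fromZero E s v := by
  have : homOfLE (zero_le (a := s)) = homOfLE (zero_le (a := r)) ≫ g := Subsingleton.elim _ _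
  rw [fromZero, fromZero, this, E.map_comp]
  rfl

theorem app_fromZero {E E' : PersMod} (F : E ⟶ E') (r : ℝ≥0) (v : E.obj 0) :
    (F.app r).hom (fromZero E r v) = fromZero E' r ((F.app 0).hom v) :=
  (congrArg (fun k => k.hom v) (F.naturality (homOfLE (zero_le (a := r)))))

/-- A basis of `E` at the origin presents `E` with end points `β` if the structure maps from the
origin are surjective and their kernels are spanned by the basis vectors `e i` for which `κ^(β i)`
has died. -/
structure IsPresentedBy (E : PersMod) {ι : Type} (e : Module.Basis ι (ZMod 2) (E.obj 0))
    (β : ι → ℝ≥0∞) : Prop where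
  surjective : ∀ r, Function.Surjective (fromZero E r)
  ker_eq : ∀ r, LinearMap.ker (fromZero E r) =
    Submodule.span (ZMod 2) (e '' {i | kappaSpace (β i) r = ⊥})

variable {E E' : PersMod} {ι : Type}

theorem IsPresentedBy.fromZero_eq_zero {e : Module.Basis ι (ZMod 2) (E.obj 0)} {β : ι → ℝ≥0∞}
    (h : IsPresentedBy E e β) {r : ℝ≥0} {i : ι} (hi : kappaSpace (β i) r = ⊥) :
    fromZero E r (e i) = 0 := by
  rw [← LinearMap.mem_ker, h.ker_eq]
  exact Submodule.subset_span ⟨i, hi, rfl⟩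

theorem IsPresentedBy.bijective {e : Module.Basis ι (ZMod 2) (E.obj 0)} {β : ι → ℝ≥0∞}
    (h : IsPresentedBy E e β) (r : ℝ≥0) :
    Function.Bijective (fromZero E r ∘ₗ combine (fun i => kappaSpace (β i) r) e) := by
  classical
  constructor
  · rw [← LinearMap.ker_eq_bot, LinearMap.ker_eq_bot']
    intro x hx
    have hmem : combine (fun i => kappaSpace (β i) r) e x ∈ LinearMap.ker (fromZero E r) := hx
    rw [h.ker_eq, e.mem_span_image] at hmem
    refine DFinsupp.ext fun i => Subtype.ext ?_
    by_cases hi : kappaSpace (β i) r = ⊥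
    · exact (Submodule.mem_bot _).1 (hi.le (x i).2)
    · have h0 : e.repr (combine (fun i => kappaSpace (β i) r) e x) i = 0 :=
        Finsupp.notMem_support_iff.1 fun hs => hi (hmem hs)
      rwa [repr_combine] at h0
  · rw [← LinearMap.range_eq_top, eq_top_iff, ← LinearMap.range_eq_top.2 (h.surjective r),
      LinearMap.range_eq_map, ← e.span_eq, Submodule.map_span, Submodule.span_le]
    rintro _ ⟨_, ⟨i, rfl⟩, rfl⟩
    rcases eq_bot_or_eq_top (kappaSpace (β i) r) with hi | hi
    · rw [h.fromZero_eq_zero hi]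
      exact Submodule.zero_mem _
    · refine ⟨DirectSum.lof (ZMod 2) ι (fun i => kappaSpace (β i) r) i
        ⟨1, hi ▸ Submodule.mem_top⟩, ?_⟩
      rw [LinearMap.comp_apply, combine_lof, one_smul]

/-- The persistence morphism `⨁ i, κ^(β i) → E` that sends the generator of `κ^(β i)` to `e i`. -/
noncomputable def IsPresentedBy.hom {e : Module.Basis ι (ZMod 2) (E.obj 0)} {β : ι → ℝ≥0∞}
    (h : IsPresentedBy E e β) : directSum (fun i => kappa (β i)) ⟶ E where
  app r := ModuleCat.ofHom (fromZero E r ∘ₗ combine (fun i => kappaSpace (β i) r) e)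
  naturality r s g := by
    have hBA : ∀ i, kappaSpace (β i) s ≤ kappaSpace (β i) r := fun i =>
      kappaSpace_anti (β i) (leOfHom g)
    refine ModuleCat.hom_ext ((map_combine_lmap hBA fun i hi => h.fromZero_eq_zero hi).trans ?_)
    exact LinearMap.ext fun x => (map_fromZero E g _).symm

theorem IsPresentedBy.isIso_hom {e : Module.Basis ι (ZMod 2) (E.obj 0)} {β : ι → ℝ≥0∞}
    (h : IsPresentedBy E e β) : IsIso h.hom := by
  have : ∀ r, IsIso (h.hom.app r) := fun r =>
    (ConcreteCategory.isIso_iff_bijective _).2 (h.bijective r)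
  exact NatIso.isIso_of_isIso_app _

/-- Compatible presentations of the source and the target of a persistence morphism decompose it
into a direct sum of morphisms between interval modules. -/
theorem nonempty_arrow_iso {e : Module.Basis ι (ZMod 2) (E.obj 0)}
    {e' : Module.Basis ι (ZMod 2) (E'.obj 0)} {α β : ι → ℝ≥0∞} (h : IsPresentedBy E e α)
    (h' : IsPresentedBy E' e' β) (hβα : ∀ i, β i ≤ α i) (F : E ⟶ E')
    (hF : ∀ i, (F.app 0).hom (e i) = e' i) :
    Nonempty (Arrow.mk F ≅ Arrow.mk (directSumHom fun i => kappaHom (hβα i))) := by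
  have := h.isIso_hom
  have := h'.isIso_hom
  refine ⟨(Arrow.isoMk (asIso h.hom) (asIso h'.hom) ?_).symm⟩
  refine NatTrans.ext (funext fun r => ModuleCat.hom_ext ?_)
  have h1 := map_combine_lmap (fun i => kappaSpace_mono (hβα i) r) fun i hi =>
    h'.fromZero_eq_zero hi
  refine Eq.trans ?_ h1.symm
  refine LinearMap.ext fun x => (app_fromZero F r _).trans (congrArg (fromZero E' r) ?_)
  exact (map_combine _ _ _ _).trans (by rw [funext hF])

end Decomposition

/-! ### Decomposition of the induced morphism -/

/-- A non-expansive bijection is a map of Vietoris-Rips graphs. -/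
def vrHom {X Z : Type} {dX : SymFun X} {dZ : SymFun Z} {f : X ≃ Z} (hf : NonExpansive dX dZ f)
    (r : ℝ≥0) : VR dX r →g VR dZ r where
  toFun := f
  map_rel' {x y} h := by
    unfold VR at h ⊢
    split_ifs at h ⊢ with hr
    · exact h
    · exact (thresholdHom hf r).map_rel h

/-- The persistence morphism `[x] ↦ [f x]` of a non-expansive bijection. -/
noncomputable def inducedHom {X Z : Type} {dX : SymFun X} {dZ : SymFun Z} {f : X ≃ Z}
    (hf : NonExpansive dX dZ f) : PH0 dX ⟶ PH0 dZ where
  app r := ModuleCat.ofHom (H0map (vrHom hf r))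
  naturality r s g := ModuleCat.hom_ext <| H0_hom_ext fun x => by
    change H0map (vrHom hf s) (rho dX (leOfHom g) (cls _ x)) =
      rho dZ (leOfHom g) (H0map (vrHom hf r) (cls _ x))
    rw [rho, rho, H0map_cls, H0map_cls, H0map_cls, H0map_cls]
    rfl

theorem kappaSpace_eq_bot_iff {a : ℝ≥0∞} {r : ℝ≥0} :
    kappaSpace a r = ⊥ ↔ r ≠ 0 ∧ a ≤ r := by
  unfold kappaSpace
  split_ifs with h
  · refine iff_of_false top_ne_bot fun h' => ?_
    exact h.elim h'.1 h'.2.not_gt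
  · exact iff_of_true rfl ⟨fun hr => h (Or.inl hr), not_lt.1 fun hr => h (Or.inr hr)⟩

/-- A basis adapted to the filtration by `ker⁺` presents the 0-persistent homology. -/
theorem isPresentedBy_PH0 {X ι : Type} {d : SymFun X}
    (e : Module.Basis ι (ZMod 2) (H0 (VR d 0))) {β : ι → ℝ≥0∞}
    (h : ∀ r : ℝ≥0, kerPlus d r = Submodule.span (ZMod 2) (e '' {i | β i ≤ r})) :
    IsPresentedBy (PH0 d) e β where
  surjective r := H0map_surjective _ Function.surjective_id
  ker_eq r := by
    change LinearMap.ker (rho d (zero_le (a := r))) = _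
    by_cases hr : r = 0
    · subst hr
      have : {i | kappaSpace (β i) 0 = ⊥} = ∅ :=
        Set.eq_empty_of_forall_notMem fun i hi => (kappaSpace_eq_bot_iff.1 hi).1 rfl
      rw [ker_rho_zero, this, Set.image_empty, Submodule.span_empty]
      rfl
    · rw [ker_rho_of_ne_zero d hr, ← kerPlus_eq, h r]
      have : {i | kappaSpace (β i) r = ⊥} = {i | β i ≤ r} :=
        Set.ext fun i => kappaSpace_eq_bot_iff.trans (and_iff_right hr)
      rw [this]
      rfl

theorem map_strictPart {V W : Type} [AddCommGroup V] [Module (ZMod 2) V] [AddCommGroup W]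
    [Module (ZMod 2) W] (φ : V →ₗ[ZMod 2] W) (P : ℝ≥0 → Submodule (ZMod 2) V) (a : ℝ≥0) :
    (strictPart P a).map φ = strictPart (fun r => (P r).map φ) a := by
  simp only [strictPart, Submodule.map_iSup]

theorem blockFun_eq {X Z : Type} (dX : SymFun X) (dZ : SymFun Z) (f : X → Z) (a b : ℝ≥0) :
    blockFun dX dZ f a b =
      dimQuot ((kerPlus dX a).map (fZero dX dZ f) ⊓ kerPlus dZ b)
        (doublePart (fun r => (kerPlus dX r).map (fZero dX dZ f)) (kerPlus dZ) a b) := by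
  rw [blockFun, blockNum, blockDen, doublePart, kerMinus_eq, kerMinus_eq, map_strictPart]

theorem exists_basis_kerPlus {X Z : Type} [Finite X] [Nonempty X] {dX : SymFun X} {dZ : SymFun Z}
    {f : X ≃ Z} (hf : NonExpansive dX dZ f) :
    ∃ e : Module.Basis (Option (CopyIndex (blockFun dX dZ f))) (ZMod 2) (H0 (VR dZ 0)),
      (∀ a : ℝ≥0, (kerPlus dX a).map (fZero dX dZ f) =
        Submodule.span (ZMod 2) (e '' {i | (endPoints (blockFun dX dZ f) i).1.1 ≤ a})) ∧
      ∀ b : ℝ≥0, kerPlus dZ b =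
        Submodule.span (ZMod 2) (e '' {i | (endPoints (blockFun dX dZ f) i).1.2 ≤ b}) := by
  have : Finite Z := Finite.of_equiv X f
  have : Nonempty Z := f.nonempty_congr.1 ‹_›
  have : Finite (VR dZ 0).ConnectedComponent := Quot.finite _
  obtain ⟨S, hS, hPS⟩ := exists_finite_kerPlus_eq dX
  obtain ⟨T, hT, hQT⟩ := exists_finite_kerPlus_eq dZ
  obtain ⟨R, hR⟩ := exists_dist_le dX
  obtain ⟨R', hR'⟩ := exists_dist_le dZ
  obtain ⟨z⟩ := ‹Nonempty Z›
  refine exists_adaptedBasis (P := fun a => (kerPlus dX a).map (fZero dX dZ f)) (Q := kerPlus dZ)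
    (U := LinearMap.ker (augmentation (VR dZ 0))) (R := R) (R' := R') (u := cls (VR dZ 0) z)
    (fun a b h => Submodule.map_mono (kerPlus_mono dX h)) (kerPlus_mono dZ)
    (map_kerPlus_le hf) hS (fun a => ?_) hT hQT (fun a => ?_) (kerPlus_le_ker_augmentation dZ) ?_
    (kerPlus_eq_ker_augmentation hR') ?_ (ker_augmentation_sup_span _ z) (blockFun_eq dX dZ f)
  · obtain ⟨s, hs, hsa, h⟩ := hPS a
    exact ⟨s, hs, hsa, by rw [h]⟩
  · rw [← map_ker_augmentation dX dZ f]
    exact Submodule.map_mono (kerPlus_le_ker_augmentation dX a)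
  · rw [← map_ker_augmentation dX dZ f, ← kerPlus_eq_ker_augmentation hR]
  · rw [LinearMap.mem_ker, augmentation_cls]
    exact one_ne_zero

theorem nonempty_inducedHom_iso {X Z : Type} [Finite X] [Nonempty X] {dX : SymFun X}
    {dZ : SymFun Z} {f : X ≃ Z} (hf : NonExpansive dX dZ f) :
    Nonempty (Arrow.mk (inducedHom hf) ≅ Arrow.mk (standardHom (blockFun dX dZ f))) := by
  obtain ⟨e, heX, heZ⟩ := exists_basis_kerPlus hf
  have hpull : ∀ r : ℝ≥0, kerPlus dX r = Submodule.span (ZMod 2)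
      ((e.map (fZeroEquiv dX dZ f).symm) ''
        {i | (endPoints (blockFun dX dZ f) i).1.1 ≤ r}) := fun r => by
    have hinj : Function.Injective (fZero dX dZ f) := (fZeroEquiv dX dZ f).injective
    apply Submodule.map_injective_of_injective hinj
    rw [heX r, Submodule.map_span, ← Set.image_comp]
    congr 1
    refine Set.image_congr fun i _ => ?_
    exact ((fZeroEquiv dX dZ f).apply_symm_apply (e i)).symm
  refine nonempty_arrow_iso (isPresentedBy_PH0 _ hpull) (isPresentedBy_PH0 e heZ)
    (fun i => (endPoints (blockFun dX dZ f) i).2) (inducedHom hf) fun i => ?_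
  have h0 : H0map (vrHom hf 0) = fZero dX dZ f := H0_hom_ext fun x => by
    rw [H0map_cls, fZero_cls]
    rfl
  change H0map (vrHom hf 0) ((fZeroEquiv dX dZ f).symm (e i)) = e i
  rw [h0]
  exact (fZeroEquiv dX dZ f).apply_symm_apply (e i)

theorem exists_shift_nonExpansive {X Z : Type} [Finite X] (dX : SymFun X) (dZ : SymFun Z)
    (f : X ≃ Z) : ∃ δ₀ : ℝ≥0, ∀ δ : ℝ≥0, δ₀ ≤ δ → NonExpansive (dX.shift δ) dZ f := by
  have : Finite Z := Finite.of_equiv X f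
  obtain ⟨R, hR⟩ := exists_dist_le dZ
  exact ⟨R, fun δ hδ x x' => (hR _ _).trans (hδ.trans le_add_self)⟩

end PersistenceMatching

theorem lemma2 {X Z : Type} [Finite X] [Nonempty X]
    (dX : PersistenceMatching.SymFun X) (dZ : PersistenceMatching.SymFun Z) (f : X ≃ Z) :
    (∃ δ₀ : ℝ≥0, ∀ δ : ℝ≥0, δ₀ ≤ δ → PersistenceMatching.NonExpansive (dX.shift δ) dZ f) ∧
    ∀ δ : ℝ≥0, PersistenceMatching.NonExpansive (dX.shift δ) dZ f →
      ∃ F : PersistenceMatching.PH0 (dX.shift δ) ⟶ PersistenceMatching.PH0 dZ,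
        (∀ (r : ℝ≥0) (x : X),
          (F.app r).hom (PersistenceMatching.cls (PersistenceMatching.VR (dX.shift δ) r) x) =
            PersistenceMatching.cls (PersistenceMatching.VR dZ r) (f x)) ∧
        -- an isomorphism in the category whose objects are the persistence morphisms and whose
        -- morphisms are the commutative squares
        Nonempty (Arrow.mk F ≅ Arrow.mk (PersistenceMatching.standardHom
          (PersistenceMatching.blockFun (dX.shift δ) dZ f))) :=
  ⟨PersistenceMatching.exists_shift_nonExpansive dX dZ f, fun _ hf =>
    ⟨PersistenceMatching.inducedHom hf, fun _ x => PersistenceMatching.H0map_cls _ x,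
      PersistenceMatching.nonempty_inducedHom_iso hf⟩⟩
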